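/- Let $\Gamma$ be a closed rectifiable Jordan curve in the complex plane, i.e. $\Gamma=\gamma([a,b])$, where $a<b$ and $\gamma:[a,b]\to\mathbb{C}$ is continuous and of bounded variation, $\gamma(a)=\gamma(b)$, and $\gamma$ is injective on $[a,b)$; let $\Gamma$ be oriented by $\gamma$. Let $\Delta\subset\mathbb{C}$ be an open disc of radius $\delta>0$, and let $h:\mathbb{C}\to\mathbb{C}$ be a bounded continuous function that is holomorphic on $\mathbb{C}\setminus K$ for some compact set $K\subset\Delta$. Then $$\left|\int_{\Gamma\cap(\overline{\Delta})^c} h(z)\,dz\right|\le 2\pi\,\|h\|_\infty\,\delta,$$ where $\|h\|_\infty=\sup_{z\in\mathbb{C}}|h(z)|$. Here, for an open set $A\subset\mathbb{C}$, $\int_{\Gamma\cap A}h(z)\,dz$ denotes the line integral $\int_{\{s\in[0,L]\,:\,\sigma(s)\in A\}}h(\sigma(s))\,\sigma'(s)\,ds$, where $L$ is the length of $\Gamma$ and $\sigma:[0,L]\to\mathbb{C}$ is the parametrization of $\Gamma$ by arc length induced by $\gamma$. -/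

import Mathlib

open Set MeasureTheory
open scoped Real BoundedContinuousFunction

/-- `γ`, restricted to the compact interval `[a, b]`, is a parametrization of a closed rectifiable
Jordan curve in the plane: it is continuous and closed, it has no self-intersection except that
its end points coincide, and it has finite length. -/
structure IsRectifiableJordanCurve (γ : ℝ → ℂ) (a b : ℝ) : Prop where
  lt : a < b
  continuousOn : ContinuousOn γ (Icc a b)
  closed : γ a = γ b
  injOn : InjOn γ (Ico a b)
  rectifiable : BoundedVariationOn γ (Icc a b)

/-- The length of the curve `γ` on `[a, b]`. -/
noncomputable def curveLength (γ : ℝ → ℂ) (a b : ℝ) : ℝ :=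
  (eVariationOn γ (Icc a b)).toReal

/-- The arc length parametrization, defined on `[0, curveLength γ a b]`, of the curve `γ` on
`[a, b]`: its value at `s` is the point `γ t` such that the length of `γ` on `[a, t]` is `s`. -/
noncomputable def arcLengthParam (γ : ℝ → ℂ) (a b : ℝ) : ℝ → ℂ :=
  naturalParameterization γ (Icc a b) a

/-- The line integral `∫_{Γ ∩ A} h(z) dz` of `h` over the part in `A` of the rectifiable curve `Γ`
parametrized by `γ` on `[a, b]`. In terms of the arc length parametrization `σ` of `Γ`, which is
`1`-Lipschitz and hence differentiable almost everywhere, it is the integral of `h (σ s) σ' (s)`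
over all `s` in `[0, length Γ]` with `σ s ∈ A`. -/
noncomputable def lineIntegralOn (γ : ℝ → ℂ) (a b : ℝ) (A : Set ℂ) (h : ℂ → ℂ) : ℂ :=
  ∫ s in {s ∈ Icc 0 (curveLength γ a b) | arcLengthParam γ a b s ∈ A},
    h (arcLengthParam γ a b s) * deriv (arcLengthParam γ a b) s

/-! For a point z inside a large circle of radius R, Cauchy's theorem on the annulus where h is
holomorphic says that the Cauchy integral of h over the circle of radius r ≥ δ about c equals the
one over the circle of radius R, minus 2πi h(z) if z lies outside the circle of radius r
(`circleIntegral_div_sub_eq`). Integrate this in z along Γ. The large circle contributes nothing,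
since Γ does not wind about points far away; exchanging integrals on the small circle leaves h(w)
times the integral of dz/(z - w) along Γ, which has modulus at most 2π for a Jordan curve. With r =
δ this would give the bound 2π‖h‖δ.

The exchange is not justified on a single circle, which Γ may meet in a bad set. So r is averaged
over (δ, δ + ε): the Cauchy kernel is integrable for area, uniformly in its pole
(`exists_setLIntegral_kernel_le`), so Fubini applies, and Γ is a null set, so almost every w is off
Γ. The indicator of the exterior becomes the ramp max(0, min(ε, |z - c| - δ)) (`setIntegral_cauchy`,
`norm_setIntegral_max_min_le`). Dividing by ε and letting ε tend to 0 restores it, by dominated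
convergence (`norm_setIntegral_outside_disc_le`).

That a Jordan curve winds at most once about any point is proved without the Jordan curve theorem
(`norm_windingIntegral_le_two_pi`). If it wound n times with |n| ≥ 2, an n-th root of f - w would be
a closed curve winding once about 0, and injectivity would make it disjoint from its rotation by
2π/n; such a curve cannot wind about 0 (`windingIntegral_zero_eq_zero_of_disjoint_rotation`). -/

open scoped NNReal ENNReal

/-! ### Arc length parametrization of a Jordan curve -/

open Filter Topology in
/-- The variation function of a continuous function of locally bounded variation is continuous. -/
theorem variationOnFromTo_continuousOn {f : ℝ → ℂ} {s : Set ℝ}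
    (hf : LocallyBoundedVariationOn f s) (hc : ContinuousOn f s) {a : ℝ} (ha : a ∈ s) :
    ContinuousOn (variationOnFromTo f s a) s := by
  intro x hx
  have hl : ContinuousWithinAt (variationOnFromTo f s a) (s ∩ Iio x) x := by
    have := variationOnFromTo.tendsto_left ha hx hf ((hc x hx).mono inter_subset_left)
    simpa [ContinuousWithinAt] using this
  have hr : ContinuousWithinAt (variationOnFromTo f s a) (s ∩ Ioi x) x := by
    have := variationOnFromTo.tendsto_right ha hx hf ((hc x hx).mono inter_subset_left)
    simpa [ContinuousWithinAt] using this
  have h0 : ContinuousWithinAt (variationOnFromTo f s a) {x} x := continuousWithinAt_singleton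
  refine ((hl.union hr).union h0).mono fun y hy => ?_
  rcases lt_trichotomy y x with h | h | h
  · exact Or.inl (Or.inl ⟨hy, h⟩)
  · exact Or.inr h
  · exact Or.inl (Or.inr ⟨hy, h⟩)

namespace IsRectifiableJordanCurve

variable {γ : ℝ → ℂ} {a b : ℝ}

theorem variationOnFromTo_right (hγ : IsRectifiableJordanCurve γ a b) :
    variationOnFromTo γ (Icc a b) a b = curveLength γ a b := by
  rw [variationOnFromTo.eq_of_le _ _ hγ.lt.le, inter_self, curveLength]

/-- Arc length is monotone and continuous, so the intermediate value theorem rules out gaps in its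
range. -/
theorem image_variationOnFromTo (hγ : IsRectifiableJordanCurve γ a b) :
    variationOnFromTo γ (Icc a b) a '' Icc a b = Icc 0 (curveLength γ a b) := by
  have hf := hγ.rectifiable.locallyBoundedVariationOn
  have ha : a ∈ Icc a b := left_mem_Icc.2 hγ.lt.le
  have hb : b ∈ Icc a b := right_mem_Icc.2 hγ.lt.le
  have hmono := variationOnFromTo.monotoneOn hf ha
  rw [← hγ.variationOnFromTo_right, ← variationOnFromTo.self γ (Icc a b) a]
  apply Subset.antisymm
  · rintro _ ⟨t, ht, rfl⟩
    exact ⟨hmono ha ht ht.1, hmono ht hb ht.2⟩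
  · exact intermediate_value_Icc hγ.lt.le
      (variationOnFromTo_continuousOn hf hγ.continuousOn ha)

theorem arcLengthParam_variationOnFromTo (hγ : IsRectifiableJordanCurve γ a b) {t : ℝ}
    (ht : t ∈ Icc a b) :
    arcLengthParam γ a b (variationOnFromTo γ (Icc a b) a t) = γ t :=
  edist_eq_zero.1 (edist_naturalParameterization_eq_zero
    hγ.rectifiable.locallyBoundedVariationOn (left_mem_Icc.2 hγ.lt.le) ht)

theorem lipschitzOnWith_arcLengthParam (hγ : IsRectifiableJordanCurve γ a b) :
    LipschitzOnWith 1 (arcLengthParam γ a b) (Icc 0 (curveLength γ a b)) := by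
  have h := has_unit_speed_naturalParameterization γ hγ.rectifiable.locallyBoundedVariationOn
    (left_mem_Icc.2 hγ.lt.le)
  rw [hγ.image_variationOnFromTo] at h
  have key : ∀ x ∈ Icc 0 (curveLength γ a b), ∀ y ∈ Icc 0 (curveLength γ a b), x ≤ y →
      edist (arcLengthParam γ a b x) (arcLengthParam γ a b y) ≤ edist x y := by
    intro x hx y hy hxy
    refine (eVariationOn.edist_le _ (s := Icc 0 (curveLength γ a b) ∩ Icc x y)
      ⟨hx, left_mem_Icc.2 hxy⟩ ⟨hy, right_mem_Icc.2 hxy⟩).trans ?_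
    rw [arcLengthParam, h hx hy, edist_comm, edist_dist, Real.dist_eq,
      abs_of_nonneg (sub_nonneg.2 hxy)]
    simp
  intro x hx y hy
  rw [ENNReal.coe_one, one_mul]
  rcases le_total x y with hxy | hxy
  · exact key x hx y hy hxy
  · rw [edist_comm, edist_comm x]
    exact key y hy x hx hxy

theorem arcLengthParam_closed (hγ : IsRectifiableJordanCurve γ a b) :
    arcLengthParam γ a b 0 = arcLengthParam γ a b (curveLength γ a b) := by
  have h1 := hγ.arcLengthParam_variationOnFromTo (left_mem_Icc.2 hγ.lt.le)
  have h2 := hγ.arcLengthParam_variationOnFromTo (right_mem_Icc.2 hγ.lt.le)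
  rw [variationOnFromTo.self] at h1
  rw [hγ.variationOnFromTo_right] at h2
  rw [h1, h2, hγ.closed]

theorem injOn_arcLengthParam (hγ : IsRectifiableJordanCurve γ a b) :
    InjOn (arcLengthParam γ a b) (Ico 0 (curveLength γ a b)) := by
  have key : ∀ s ∈ Ico 0 (curveLength γ a b),
      ∃ t ∈ Ico a b, variationOnFromTo γ (Icc a b) a t = s := by
    intro s hs
    obtain ⟨t, ht, rfl⟩ := hγ.image_variationOnFromTo.symm ▸ Ico_subset_Icc_self hs
    refine ⟨t, ⟨ht.1, lt_of_le_of_ne ht.2 ?_⟩, rfl⟩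
    rintro rfl
    exact hs.2.ne hγ.variationOnFromTo_right
  intro s hs s' hs' h
  obtain ⟨t, ht, rfl⟩ := key s hs
  obtain ⟨t', ht', rfl⟩ := key s' hs'
  rw [hγ.arcLengthParam_variationOnFromTo (Ico_subset_Icc_self ht),
    hγ.arcLengthParam_variationOnFromTo (Ico_subset_Icc_self ht')] at h
  rw [hγ.injOn ht ht' h]

end IsRectifiableJordanCurve

/-! ### Lipschitz functions on an interval -/

/-- A function on a compact interval that is Lipschitz there extends to a Lipschitz function. -/
theorem LipschitzOnWith.exists_lipschitzWith_eqOn_Icc {f : ℝ → ℂ} {C : ℝ≥0} {L : ℝ} (hL : 0 ≤ L)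
    (hf : LipschitzOnWith C f (Icc 0 L)) :
    ∃ g : ℝ → ℂ, LipschitzWith C g ∧ EqOn f g (Icc 0 L) := by
  refine ⟨IccExtend hL ((Icc 0 L).domRestrict f), ?_, fun t ht => ?_⟩
  · simpa [IccExtend] using (lipschitzOnWith_iff_restrict.1 hf).comp (LipschitzWith.projIcc hL)
  · rw [IccExtend_of_mem hL _ ht, domRestrict_apply]

theorem LipschitzOnWith.exp_comp {f : ℝ → ℂ} {C : ℝ≥0} {s : Set ℝ} (hs : IsCompact s)
    (hf : LipschitzOnWith C f s) : ∃ K, LipschitzOnWith K (fun t => Complex.exp (f t)) s := by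
  obtain ⟨K, hK⟩ := (Complex.contDiff_exp (𝕜 := ℂ) (n := 1)).locallyLipschitz.locallyLipschitzOn
    (s := f '' s) |>.exists_lipschitzOnWith_of_compact (hs.image_of_continuousOn hf.continuousOn)
  exact ⟨K * C, hK.comp hf (mapsTo_image f s)⟩

theorem EqOn.deriv_eqOn_Ioo {f g : ℝ → ℂ} {a b : ℝ} (h : EqOn f g (Icc a b)) :
    EqOn (deriv f) (deriv g) (Ioo a b) := fun _ ht =>
  Filter.EventuallyEq.deriv_eq (Filter.eventuallyEq_of_mem (Icc_mem_nhds ht.1 ht.2) h)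

/-! ### Winding integrals of closed Lipschitz curves -/

/-- The integral of `dz / (z - w)` along the curve `f` on `[0, L]`. For a closed curve it is `2πi`
times the winding number of the curve about `w`. -/
noncomputable def windingIntegral (f : ℝ → ℂ) (L : ℝ) (w : ℂ) : ℂ :=
  ∫ t in 0..L, deriv f t / (f t - w)

section winding

variable {f : ℝ → ℂ} {C : ℝ≥0} {L : ℝ} {w : ℂ}

theorem exists_pos_le_norm_sub (hf : Continuous f) (hw : w ∉ f '' Icc 0 L) :
    ∃ d > 0, ∀ t ∈ Icc 0 L, d ≤ ‖f t - w‖ := by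
  obtain ⟨d, hd, hball⟩ := Metric.isOpen_iff.1
    (isCompact_Icc.image hf).isClosed.isOpen_compl w hw
  refine ⟨d, hd, fun t ht => not_lt.1 fun h => hball ?_ (mem_image_of_mem f ht)⟩
  rwa [Metric.mem_ball, dist_eq_norm]

theorem norm_deriv_div_le (hf : LipschitzWith C f) {d : ℝ} (hd : 0 < d) {t : ℝ}
    (h : d ≤ ‖f t - w‖) : ‖deriv f t / (f t - w)‖ ≤ C / d := by
  rw [norm_div]
  exact div_le_div₀ C.2 (norm_deriv_le_of_lipschitz hf) hd h

theorem measurable_deriv_div (hf : LipschitzWith C f) :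
    Measurable fun t => deriv f t / (f t - w) :=
  (measurable_deriv f).div (hf.continuous.measurable.sub_const w)

theorem intervalIntegrable_deriv_div (hL : 0 ≤ L) (hf : LipschitzWith C f)
    (hw : w ∉ f '' Icc 0 L) :
    IntervalIntegrable (fun t => deriv f t / (f t - w)) volume 0 L := by
  obtain ⟨d, hd, h⟩ := exists_pos_le_norm_sub hf.continuous hw
  rw [intervalIntegrable_iff_integrableOn_Ioc_of_le hL]
  refine Measure.integrableOn_of_bounded (M := C / d) (by simp)
    (measurable_deriv_div hf).aestronglyMeasurable ?_
  filter_upwards [ae_restrict_mem measurableSet_Ioc] with t ht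
  exact norm_deriv_div_le hf hd (h t (Ioc_subset_Icc_self ht))

theorem exists_lipschitzOnWith_integral_deriv_div (hL : 0 ≤ L) (hf : LipschitzWith C f)
    (hw : w ∉ f '' Icc 0 L) :
    ∃ K, LipschitzOnWith K (fun t => ∫ s in 0..t, deriv f s / (f s - w)) (Icc 0 L) := by
  obtain ⟨d, hd, h⟩ := exists_pos_le_norm_sub hf.continuous hw
  have hi := intervalIntegrable_deriv_div hL hf hw
  have hsub : ∀ t ∈ Icc 0 L, IntervalIntegrable (fun t => deriv f t / (f t - w)) volume 0 t :=
    fun t ht => hi.mono_set (by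
      rw [uIcc_of_le hL, uIcc_of_le ht.1]
      exact Icc_subset_Icc_right ht.2)
  refine ⟨C / ⟨d, hd.le⟩, LipschitzOnWith.of_dist_le_mul fun x hx y hy => ?_⟩
  rw [dist_eq_norm, intervalIntegral.integral_interval_sub_left (hsub x hx) (hsub y hy),
    Real.dist_eq]
  refine intervalIntegral.norm_integral_le_of_norm_le_const fun t ht => ?_
  refine norm_deriv_div_le hf hd (h t ?_)
  rw [uIoc_eq_union] at ht
  rcases ht with ht | ht
  · exact ⟨hy.1.trans ht.1.le, ht.2.trans hx.2⟩
  · exact ⟨hx.1.trans ht.1.le, ht.2.trans hy.2⟩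

theorem ae_hasDerivAt_integral_deriv_div (hL : 0 ≤ L) (hf : LipschitzWith C f)
    (hw : w ∉ f '' Icc 0 L) :
    ∀ᵐ t, t ∈ Icc 0 L →
      HasDerivAt (fun t => ∫ s in 0..t, deriv f s / (f s - w)) (deriv f t / (f t - w)) t := by
  filter_upwards [(intervalIntegrable_deriv_div hL hf hw).ae_hasDerivAt_integral] with t ht htL
  rw [uIcc_of_le hL] at ht
  exact ht htL 0 (left_mem_Icc.2 hL)

/-- The integral of `f' / (f - w)` is a logarithm of `f - w`. -/
theorem sub_eq_mul_exp_integral (hL : 0 ≤ L) (hf : LipschitzWith C f)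
    (hw : w ∉ f '' Icc 0 L) {t : ℝ} (ht : t ∈ Icc 0 L) :
    f t - w = (f 0 - w) * Complex.exp (∫ s in 0..t, deriv f s / (f s - w)) := by
  set G : ℝ → ℂ := fun t => ∫ s in 0..t, deriv f s / (f s - w) with hG
  obtain ⟨K, hK⟩ := exists_lipschitzOnWith_integral_deriv_div hL hf hw
  have hKneg : LipschitzOnWith K (fun t => -G t) (Icc 0 L) := fun x hx y hy => by
    rw [edist_neg_neg]; exact hK hx hy
  obtain ⟨K', hK'⟩ := LipschitzOnWith.exp_comp isCompact_Icc hKneg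
  rw [← uIcc_of_le hL] at hK'
  -- The product exp(-G)(f - w) has derivative zero only almost everywhere; absolute continuity is
  -- what makes it constant.
  have hac : AbsolutelyContinuousOnInterval (fun t => Complex.exp (-G t) • (f t - w)) 0 L := by
    refine AbsolutelyContinuousOnInterval.fun_smul hK'.absolutelyContinuousOnInterval ?_
    refine LipschitzOnWith.absolutelyContinuousOnInterval (K := C) fun x _ y _ => ?_
    rw [edist_sub_right]
    exact hf x y
  obtain ⟨c, hc⟩ := hac.const_of_ae_hasDerivAt_zero (by
    filter_upwards [ae_hasDerivAt_integral_deriv_div hL hf hw, hf.ae_differentiableAt_real]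
      with t ht hd htL
    rw [uIcc_of_le hL] at htL
    have hne : f t - w ≠ 0 := fun h => hw ⟨t, htL, sub_eq_zero.1 h⟩
    have := ((ht htL).fun_neg.cexp).fun_smul (hd.hasDerivAt.sub_const w)
    refine this.congr_deriv ?_
    simp only [smul_eq_mul]
    field_simp
    ring)
  have h0 := hc 0 (by simp)
  rw [uIcc_of_le hL] at hc
  have h1 := (hc t ht).trans h0.symm
  have hG0 : G 0 = 0 := intervalIntegral.integral_same
  simp only [smul_eq_mul, hG0, neg_zero, Complex.exp_zero, one_mul] at h1
  rw [← h1, mul_right_comm, ← Complex.exp_add, neg_add_cancel, Complex.exp_zero, one_mul]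

theorem exists_windingIntegral_eq (hL : 0 ≤ L) (hf : LipschitzWith C f) (hcl : f 0 = f L)
    (hw : w ∉ f '' Icc 0 L) : ∃ n : ℤ, windingIntegral f L w = n * (2 * π * Complex.I) := by
  rw [← Complex.exp_eq_one_iff]
  have h := sub_eq_mul_exp_integral hL hf hw (right_mem_Icc.2 hL)
  have hne : f 0 - w ≠ 0 := fun h => hw ⟨0, left_mem_Icc.2 hL, sub_eq_zero.1 h⟩
  rw [← hcl] at h
  exact mul_left_cancel₀ hne (by rw [mul_one]; exact h.symm)

theorem norm_windingIntegral_le (hL : 0 ≤ L) (hf : LipschitzWith C f) {d : ℝ} (hd : 0 < d)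
    (h : ∀ t ∈ Icc 0 L, d ≤ ‖f t - w‖) : ‖windingIntegral f L w‖ ≤ C / d * L := by
  have := intervalIntegral.norm_integral_le_of_norm_le_const (a := 0) (b := L) (C := C / d)
    (f := fun t => deriv f t / (f t - w)) fun t ht => norm_deriv_div_le hf hd (h t ?_)
  · rwa [sub_zero, abs_of_nonneg hL] at this
  · rw [uIoc_of_le hL] at ht
    exact Ioc_subset_Icc_self ht

theorem continuousOn_windingIntegral (hL : 0 ≤ L) (hf : LipschitzWith C f) :
    ContinuousOn (windingIntegral f L) (f '' Icc 0 L)ᶜ := by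
  intro w hw
  obtain ⟨d, hd, h⟩ := exists_pos_le_norm_sub hf.continuous hw
  refine ContinuousAt.continuousWithinAt ?_
  refine intervalIntegral.continuousAt_of_dominated_interval (bound := fun _ => C / (d / 2))
    (Filter.Eventually.of_forall fun v => (measurable_deriv_div hf).aestronglyMeasurable) ?_
    intervalIntegrable_const ?_
  · filter_upwards [Metric.ball_mem_nhds w (half_pos hd)] with v hv
    refine Filter.Eventually.of_forall fun t ht => norm_deriv_div_le hf (half_pos hd) ?_
    rw [uIoc_of_le hL] at ht
    have h1 := h t (Ioc_subset_Icc_self ht)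
    rw [Metric.mem_ball, dist_eq_norm] at hv
    have h2 := norm_sub_le_norm_sub_add_norm_sub (f t) v w
    linarith
  · refine Filter.Eventually.of_forall fun t ht => ?_
    rw [uIoc_of_le hL] at ht
    have hne : f t - w ≠ 0 := fun h => hw ⟨t, Ioc_subset_Icc_self ht, sub_eq_zero.1 h⟩
    exact continuousAt_const.div (continuousAt_const.sub continuousAt_id) hne

/-- Divided by 2πi, the winding integral is continuous off the curve and takes integer values, hence
is constant on preconnected sets. -/
theorem windingIntegral_eq_of_isPreconnected (hL : 0 ≤ L) (hf : LipschitzWith C f)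
    (hcl : f 0 = f L) {S : Set ℂ} (hS : IsPreconnected S) (hd : Disjoint S (f '' Icc 0 L))
    {x y : ℂ} (hx : x ∈ S) (hy : y ∈ S) : windingIntegral f L x = windingIntegral f L y := by
  have hne : (2 * π * Complex.I) ≠ 0 := Complex.two_pi_I_ne_zero
  have hsub : S ⊆ (f '' Icc 0 L)ᶜ := hd.subset_compl_right
  have hcont : ContinuousOn (fun w => (windingIntegral f L w / (2 * π * Complex.I)).re) S :=
    Complex.continuous_re.comp_continuousOn
      (((continuousOn_windingIntegral hL hf).mono hsub).div_const _)
  have hmaps : MapsTo (fun w => (windingIntegral f L w / (2 * π * Complex.I)).re) S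
      (range ((↑) : ℤ → ℝ)) := by
    intro w hw
    obtain ⟨n, hn⟩ := exists_windingIntegral_eq hL hf hcl (hsub hw)
    exact ⟨n, by simp only [hn, mul_div_cancel_right₀ _ hne, Complex.intCast_re]⟩
  have h := hS.constant_of_mapsTo
    Int.isClosedEmbedding_coe_real.isEmbedding.isInducing.isDiscrete_range hcont hmaps hx hy
  obtain ⟨n, hn⟩ := exists_windingIntegral_eq hL hf hcl (hsub hx)
  obtain ⟨m, hm⟩ := exists_windingIntegral_eq hL hf hcl (hsub hy)
  simp only [hn, hm, mul_div_cancel_right₀ _ hne, Complex.intCast_re, Int.cast_inj] at h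
  rw [hn, hm, h]

/-- The winding integral vanishes about a point off the curve that is at least as far from some
point `c` as every point of the curve. -/
theorem windingIntegral_eq_zero_of_norm_le (hL : 0 ≤ L) (hf : LipschitzWith C f)
    (hcl : f 0 = f L) {c : ℂ} (hw : w ∉ f '' Icc 0 L) (h : ∀ t ∈ Icc 0 L, ‖f t - c‖ ≤ ‖w - c‖) :
    windingIntegral f L w = 0 := by
  have hwc : 0 < ‖w - c‖ := by
    rw [norm_pos_iff, sub_ne_zero]
    rintro rfl
    have := h 0 (left_mem_Icc.2 hL)
    rw [sub_self, norm_zero, norm_le_zero_iff, sub_eq_zero] at this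
    exact hw ⟨0, left_mem_Icc.2 hL, this⟩
  have hnorm : ∀ r : ℝ, 1 ≤ r → ‖c + r * (w - c) - c‖ = r * ‖w - c‖ := fun r hr => by
    rw [add_sub_cancel_left, norm_mul, Complex.norm_real, Real.norm_of_nonneg (by linarith)]
  -- The ray from w pointing away from c avoids the curve, so the winding integral is constant on
  -- it; it also decays at infinity.
  have hS : IsPreconnected ((fun r : ℝ => c + r * (w - c)) '' Ici 1) :=
    isPreconnected_Ici.image _ (by fun_prop)
  have hdisj : Disjoint ((fun r : ℝ => c + r * (w - c)) '' Ici 1) (f '' Icc 0 L) := by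
    rw [disjoint_left]
    rintro _ ⟨r, hr, rfl⟩ ⟨t, ht, hft⟩
    rcases (mem_Ici.1 hr).eq_or_lt with rfl | hr'
    · exact hw ⟨t, ht, by simpa using hft⟩
    · have h1 := h t ht
      simp only at hft
      rw [hft, hnorm r hr] at h1
      nlinarith
  have hconst : ∀ r : ℝ, 1 ≤ r →
      windingIntegral f L w = windingIntegral f L (c + r * (w - c)) := fun r hr =>
    windingIntegral_eq_of_isPreconnected hL hf hcl hS hdisj ⟨1, self_mem_Ici, by simp⟩
      ⟨r, hr, rfl⟩
  have hbound : ∀ r : ℝ, 1 < r → ‖windingIntegral f L w‖ ≤ C / ((r - 1) * ‖w - c‖) * L := by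
    intro r hr
    rw [hconst r hr.le]
    refine norm_windingIntegral_le hL hf (mul_pos (by linarith) hwc) fun t ht => ?_
    have h1 := norm_sub_norm_le (c + r * (w - c) - c) (f t - c)
    rw [hnorm r hr.le, sub_sub_sub_cancel_right, norm_sub_rev _ (f t)] at h1
    have := h t ht
    linarith
  have hlim : Filter.Tendsto (fun r : ℝ => C / ((r - 1) * ‖w - c‖) * L) Filter.atTop (nhds 0) := by
    have h1 : Filter.Tendsto (fun r : ℝ => (r - 1) * ‖w - c‖) Filter.atTop Filter.atTop :=
      (Filter.tendsto_atTop_add_const_right _ (-1) Filter.tendsto_id).atTop_mul_const hwc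
    simpa using (h1.const_div_atTop (C : ℝ)).mul_const L
  have := ge_of_tendsto hlim (Filter.eventually_gt_atTop 1 |>.mono hbound)
  exact norm_le_zero_iff.1 this

end winding

/-! ### Jordan curves wind at most once -/

/-- A closed Lipschitz curve on `[0, L]` which has a rotation about `0`, disjoint from it, does not
wind around `0`. -/
theorem windingIntegral_zero_eq_zero_of_disjoint_rotation {k : ℝ → ℂ} {C : ℝ≥0} {L : ℝ}
    (hL : 0 ≤ L) (hk : LipschitzWith C k) (hcl : k 0 = k L) {ω : ℂ} (hω : ‖ω‖ = 1)
    (hdisj : ∀ s ∈ Icc 0 L, ∀ t ∈ Icc 0 L, k s ≠ ω * k t) : windingIntegral k L 0 = 0 := by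
  have hne : (Icc 0 L).Nonempty := nonempty_Icc.2 hL
  have hcont : ContinuousOn (fun t => ‖k t‖) (Icc 0 L) := hk.continuous.norm.continuousOn
  have hnorm : ∀ t, ‖ω * k t‖ = ‖k t‖ := fun t => by rw [norm_mul, hω, one_mul]
  -- The rotated curve is connected and misses k. Its farthest point from 0 has winding integral 0,
  -- which passes along the rotated curve to its nearest point, and from there along a radius to 0.
  obtain ⟨t₁, ht₁, hmax⟩ := isCompact_Icc.exists_isMaxOn hne hcont
  obtain ⟨t₂, ht₂, hmin⟩ := isCompact_Icc.exists_isMinOn hne hcont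
  have hrot : ∀ t ∈ Icc 0 L, ω * k t ∉ k '' Icc 0 L := by
    rintro t ht ⟨s, hs, hst⟩
    exact hdisj s hs t ht hst
  have h₁ : windingIntegral k L (ω * k t₁) = 0 :=
    windingIntegral_eq_zero_of_norm_le hL hk hcl (c := 0) (hrot t₁ ht₁) fun t ht => by
      rw [sub_zero, sub_zero, hnorm]
      exact hmax ht
  have h₂ : windingIntegral k L (ω * k t₂) = windingIntegral k L (ω * k t₁) := by
    refine windingIntegral_eq_of_isPreconnected hL hk hcl (S := (fun t => ω * k t) '' Icc 0 L)
      (isPreconnected_Icc.image _ (hk.continuous.const_mul ω).continuousOn) ?_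
      ⟨t₂, ht₂, rfl⟩ ⟨t₁, ht₁, rfl⟩
    rw [disjoint_left]
    rintro _ ⟨t, ht, rfl⟩
    exact hrot t ht
  have h₃ : windingIntegral k L 0 = windingIntegral k L (ω * k t₂) := by
    refine windingIntegral_eq_of_isPreconnected hL hk hcl
      (S := (fun r : ℝ => r * (ω * k t₂)) '' Icc 0 1)
      (isPreconnected_Icc.image _ (by fun_prop)) ?_ ⟨0, by simp, by simp⟩ ⟨1, by simp, by simp⟩
    rw [disjoint_left]
    rintro _ ⟨r, hr, rfl⟩ ⟨t, ht, hkt⟩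
    simp only at hkt
    rcases hr.2.eq_or_lt with rfl | hr1
    · exact hrot t₂ ht₂ ⟨t, ht, by simpa using hkt⟩
    -- The radius below the minimum modulus can meet k only if k passes through 0, which its
    -- rotation would then also do.
    · have hle : ‖k t₂‖ ≤ ‖k t‖ := hmin ht
      have heq := congrArg norm hkt
      rw [norm_mul, hnorm, Complex.norm_real, Real.norm_of_nonneg hr.1] at heq
      have hzero : ‖k t₂‖ = 0 := by nlinarith [norm_nonneg (k t₂)]
      have hk₂ := norm_eq_zero.1 hzero
      exact hrot t₂ ht₂ ⟨t₂, ht₂, by rw [hk₂, mul_zero]⟩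
  rw [h₃, h₂, h₁]

/-- A winding number n with |n| ≥ 2 would give an n-th root k of f - w winding exactly once about 0.
Points of k with the same n-th power come from the same point of f, hence coincide, so k is disjoint
from its rotation by a primitive |n|-th root of unity, a contradiction. -/
theorem norm_windingIntegral_le_two_pi {f : ℝ → ℂ} {C : ℝ≥0} {L : ℝ} {w : ℂ}
    (hL : 0 ≤ L) (hf : LipschitzWith C f) (hcl : f 0 = f L) (hinj : InjOn f (Ico 0 L))
    (hw : w ∉ f '' Icc 0 L) : ‖windingIntegral f L w‖ ≤ 2 * π := by
  obtain ⟨n, hn⟩ := exists_windingIntegral_eq hL hf hcl hw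
  by_contra! hlt
  have hn2 : 1 < |n| := by
    rw [hn, norm_mul, Complex.norm_intCast, norm_mul, Complex.norm_I, mul_one,
      ← Complex.ofReal_ofNat, ← Complex.ofReal_mul, Complex.norm_real,
      Real.norm_of_nonneg Real.two_pi_pos.le] at hlt
    have : (1 : ℝ) < |(n : ℝ)| := by nlinarith [Real.two_pi_pos]
    exact_mod_cast this
  have hn0 : (n : ℂ) ≠ 0 := by
    rw [Int.cast_ne_zero]
    rintro rfl
    simp at hn2
  have hL0 : 0 < L := by
    refine lt_of_le_of_ne hL ?_
    rintro rfl
    rw [windingIntegral, intervalIntegral.integral_same] at hn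
    exact mul_ne_zero hn0 Complex.two_pi_I_ne_zero hn.symm
  have h0 : (0 : ℝ) ∈ Icc 0 L := left_mem_Icc.2 hL
  have hLm : L ∈ Icc 0 L := right_mem_Icc.2 hL
  -- the curve `k` is an `n`-th root of `f - w`
  set G : ℝ → ℂ := fun t => ∫ s in 0..t, deriv f s / (f s - w) with hG
  set l : ℝ → ℂ := fun t => (n : ℂ)⁻¹ * (Complex.log (f 0 - w) + G t) with hl
  -- The logarithm grows by 2πi n over the whole curve, so its n-th part grows by 2πi and k closes
  -- up.
  have hGL : G L = n * (2 * π * Complex.I) := hn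
  have hpow : ∀ t ∈ Icc 0 L, Complex.exp (l t) ^ n = f t - w := fun t ht => by
    have hne : f 0 - w ≠ 0 := fun h => hw ⟨0, h0, sub_eq_zero.1 h⟩
    rw [← Complex.exp_int_mul, hl, mul_inv_cancel_left₀ hn0, Complex.exp_add,
      Complex.exp_log hne, sub_eq_mul_exp_integral hL hf hw ht]
  obtain ⟨K, hK⟩ := exists_lipschitzOnWith_integral_deriv_div hL hf hw
  have hlip : LipschitzOnWith (‖(n : ℂ)⁻¹‖₊ * K) l (Icc 0 L) :=
    LipschitzOnWith.of_dist_le_mul fun x hx y hy => by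
      rw [hl, dist_eq_norm, ← mul_sub, add_sub_add_left_eq_sub, norm_mul, NNReal.coe_mul,
        coe_nnnorm, mul_assoc, ← dist_eq_norm]
      exact mul_le_mul_of_nonneg_left (hK.dist_le_mul x hx y hy) (norm_nonneg _)
  obtain ⟨K', hK'⟩ := LipschitzOnWith.exp_comp isCompact_Icc hlip
  obtain ⟨k, hk, hek⟩ := hK'.exists_lipschitzWith_eqOn_Icc hL
  have hkcl : k 0 = k L := by
    rw [← hek h0, ← hek hLm]
    have hG0 : G 0 = 0 := intervalIntegral.integral_same
    simp only [hl, hGL, hG0, mul_add, inv_mul_cancel_left₀ hn0, Complex.exp_add, mul_zero,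
      Complex.exp_zero, Complex.exp_two_pi_mul_I]
  have hkinj : ∀ s ∈ Icc 0 L, ∀ t ∈ Icc 0 L, f s = f t → k s = k t := by
    have hred : ∀ s ∈ Icc 0 L, ∃ s' ∈ Ico 0 L, f s = f s' ∧ k s = k s' := fun s hs => by
      rcases hs.2.eq_or_lt with rfl | hlt
      · exact ⟨0, ⟨le_rfl, hL0⟩, hcl.symm, hkcl.symm⟩
      · exact ⟨s, ⟨hs.1, hlt⟩, rfl, rfl⟩
    intro s hs t ht hst
    obtain ⟨s', hs', h1, h2⟩ := hred s hs
    obtain ⟨t', ht', h3, h4⟩ := hred t ht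
    rw [h2, h4, hinj hs' ht' (by rw [← h1, hst, h3])]
  have hkne : ∀ t ∈ Icc 0 L, k t ≠ 0 := fun t ht => by
    rw [← hek ht]
    exact Complex.exp_ne_zero _
  set ω : ℂ := Complex.exp ((2 * π / n : ℝ) * Complex.I) with hω
  have hω1 : ω ≠ 1 := by
    intro h
    obtain ⟨m, hm⟩ := Complex.exp_eq_one_iff.1 (hω ▸ h)
    have h1 : (1 : ℂ) = m * n := by
      have := Complex.two_pi_I_ne_zero
      push_cast at hm
      field_simp at hm
      rw [hm, mul_comm]
    have h2 : m * n = 1 := by exact_mod_cast h1.symm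
    -- If ω were 1, then n would divide 1; this is where |n| > 1 is needed.
    rcases Int.isUnit_iff.1 (IsUnit.of_mul_eq_one_right _ h2) with rfl | rfl <;> simp at hn2
  have hωn : ω ^ n = 1 := by
    rw [hω, ← Complex.exp_int_mul]
    push_cast
    rw [← mul_assoc, mul_div_cancel₀ _ hn0, Complex.exp_two_pi_mul_I]
  have hzero : windingIntegral k L 0 = 0 := by
    refine windingIntegral_zero_eq_zero_of_disjoint_rotation hL hk hkcl (ω := ω)
      (Complex.norm_exp_ofReal_mul_I _) fun s hs t ht hst => ?_
    have h1 : k s ^ n = k t ^ n := by rw [hst, mul_zpow, hωn, one_mul]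
    rw [← hek hs, ← hek ht, hpow s hs, hpow t ht, sub_left_inj] at h1
    have h2 := hkinj s hs t ht h1
    rw [h2] at hst
    exact hω1 (mul_right_cancel₀ (hkne t ht) (by rw [one_mul, ← hst]))
  have hval : windingIntegral k L 0 = (n : ℂ)⁻¹ * windingIntegral f L w := by
    rw [windingIntegral, windingIntegral, ← intervalIntegral.integral_const_mul]
    refine intervalIntegral.integral_congr_ae ?_
    filter_upwards [ae_hasDerivAt_integral_deriv_div hL hf hw, Measure.ae_ne volume L]
      with t ht htL htm
    rw [uIoc_of_le hL] at htm
    have htm' : t ∈ Ioo 0 L := ⟨htm.1, lt_of_le_of_ne htm.2 htL⟩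
    have hd := (((ht (Ioo_subset_Icc_self htm')).const_add
      (Complex.log (f 0 - w))).const_mul (n : ℂ)⁻¹).cexp.deriv
    rw [← EqOn.deriv_eqOn_Ioo hek htm', sub_zero, ← hek (Ioo_subset_Icc_self htm')]
    exact (congrArg (· / _) hd).trans (mul_div_cancel_left₀ _ (Complex.exp_ne_zero _))
  rw [hval, hn, inv_mul_cancel_left₀ hn0] at hzero
  exact Complex.two_pi_I_ne_zero hzero

/-! ### Cauchy's formula on an annulus -/

/-- Serves to remove the pole at z: the difference quotient extends holomorphically, so it has equal
integrals over both circles of an annulus containing z. -/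
theorem circleIntegral_dslope {h : ℂ → ℂ} {c z : ℂ} {ρ : ℝ} (hρ : 0 < ρ)
    (hc : ContinuousOn h (Metric.sphere c ρ)) (hz : z ∉ Metric.sphere c ρ) :
    (∮ w in C(c, ρ), dslope h z w) =
      (∮ w in C(c, ρ), h w / (w - z)) - h z * ∮ w in C(c, ρ), (w - z)⁻¹ := by
  have hne : ∀ w ∈ Metric.sphere c ρ, w - z ≠ 0 := fun w hw h => hz (sub_eq_zero.1 h ▸ hw)
  have hci : ContinuousOn (fun w => (w - z)⁻¹) (Metric.sphere c ρ) :=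
    (continuousOn_id.sub continuousOn_const).inv₀ hne
  have hchi : ContinuousOn (fun w => h z * (w - z)⁻¹) (Metric.sphere c ρ) :=
    continuousOn_const.mul hci
  have hcd : ContinuousOn (fun w => h w / (w - z)) (Metric.sphere c ρ) :=
    hc.div (continuousOn_id.sub continuousOn_const) hne
  rw [← circleIntegral.integral_const_mul, ← circleIntegral.integral_sub
    (hcd.circleIntegrable hρ.le) (hchi.circleIntegrable hρ.le)]
  refine circleIntegral.integral_congr hρ.le fun w hw => ?_
  rw [dslope_of_ne _ (sub_ne_zero.1 (hne w hw)), slope_def_field, sub_div,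
    div_eq_mul_inv (h z)]

/-- The Cauchy integral of a function holomorphic outside a disc, over circles of radii `r < R`. -/
theorem circleIntegral_div_sub_eq {h : ℂ → ℂ} {c z : ℂ} {r R : ℝ} (hr : 0 < r) (hrR : r ≤ R)
    (hh : ∀ w, r ≤ ‖w - c‖ → DifferentiableAt ℂ h w) (hzR : ‖z - c‖ < R) (hzr : ‖z - c‖ ≠ r) :
    (∮ w in C(c, r), h w / (w - z)) = (∮ w in C(c, R), h w / (w - z)) -
      if r < ‖z - c‖ then 2 * π * Complex.I * h z else 0 := by
  have hann : ∀ w ∈ Metric.closedBall c R \ Metric.ball c r, DifferentiableAt ℂ h w :=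
    fun w hw => hh w (by simpa [dist_eq_norm] using hw.2)
  have hann' : ∀ w ∈ (Metric.ball c R \ Metric.closedBall c r), DifferentiableAt ℂ h w :=
    fun w hw => hann w ⟨Metric.ball_subset_closedBall hw.1,
      fun hw' => hw.2 (Metric.ball_subset_closedBall hw')⟩
  split_ifs with hlt
  · have hzs : ∀ ρ, ρ ≠ ‖z - c‖ → z ∉ Metric.sphere c ρ := fun ρ hρ h =>
      hρ (by rw [← mem_sphere_iff_norm.1 h])
    have hcs : ∀ ρ, r ≤ ρ → ContinuousOn h (Metric.sphere c ρ) := fun ρ hρ w hw =>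
      (hh w (by rw [mem_sphere_iff_norm.1 hw]; exact hρ)).continuousAt.continuousWithinAt
    have key := Complex.circleIntegral_eq_of_differentiable_on_annulus_off_countable hr hrR
      (f := dslope h z) (countable_singleton z) (fun w hw => by
        rcases eq_or_ne w z with rfl | hne
        · exact (continuousAt_dslope_same.2 (hann w hw)).continuousWithinAt
        · exact ((differentiableAt_dslope_of_ne hne).2 (hann w hw)).continuousAt.continuousWithinAt)
      (fun w hw => (differentiableAt_dslope_of_ne hw.2).2 (hann' w hw.1))
    have hzero : (∮ w in C(c, r), (w - z)⁻¹) = 0 := by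
      have hne : ∀ w ∈ Metric.closedBall c r, w - z ≠ 0 := fun w hw h => by
        rw [sub_eq_zero.1 h, Metric.mem_closedBall, dist_eq_norm] at hw
        linarith
      refine Complex.circleIntegral_eq_zero_of_differentiable_on_off_countable hr.le countable_empty
        ((continuousOn_id.sub continuousOn_const).inv₀ hne) fun w hw => ?_
      exact (differentiableAt_id.sub_const z).inv (hne w (Metric.ball_subset_closedBall hw.1))
    rw [circleIntegral_dslope (hr.trans_le hrR) (hcs R hrR) (hzs R hzR.ne'),
      circleIntegral_dslope hr (hcs r le_rfl) (hzs r hlt.ne), hzero,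
      circleIntegral.integral_sub_inv_of_mem_ball (by simpa [dist_eq_norm] using hzR)] at key
    rw [mul_zero, sub_zero] at key
    rw [← key, mul_comm (h z)]
  · have hlt' : ‖z - c‖ < r := lt_of_le_of_ne (not_lt.1 hlt) hzr
    have hne : ∀ w, w ∉ Metric.ball c r → w - z ≠ 0 := fun w hw h => hw (by
      rw [sub_eq_zero.1 h, Metric.mem_ball, dist_eq_norm]
      exact hlt')
    rw [sub_zero]
    refine (Complex.circleIntegral_eq_of_differentiable_on_annulus_off_countable hr hrR
      countable_empty (fun w hw => ?_) fun w hw => ?_).symm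
    · exact ((hann w hw).continuousAt.div (continuousAt_id.sub continuousAt_const)
        (hne w hw.2)).continuousWithinAt
    · exact (hann' w hw.1).div (differentiableAt_id.sub_const z)
        (hne w fun hw' => hw.1.2 (Metric.ball_subset_closedBall hw'))

/-! ### Polar coordinates and integrability of the Cauchy kernel -/

theorem continuous_circleMap_uncurried (c : ℂ) :
    Continuous fun p : ℝ × ℝ => circleMap c p.1 p.2 := by
  unfold circleMap
  fun_prop

theorem circleMap_eq_add_polarCoord_symm (c : ℂ) (p : ℝ × ℝ) :
    circleMap c p.1 p.2 = Complex.polarCoord.symm p + c := by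
  rw [circleMap, Complex.polarCoord_symm_apply, Complex.exp_mul_I, add_comm]
  push_cast
  rfl

theorem circleIntegral_eq_setIntegral_Ioo (f : ℂ → ℂ) (c : ℂ) (r : ℝ) :
    (∮ w in C(c, r), f w) =
      ∫ θ in Ioo (-π) π, circleMap 0 r θ * Complex.I * f (circleMap c r θ) := by
  have hper : Function.Periodic (fun θ => deriv (circleMap c r) θ • f (circleMap c r θ))
      (2 * π) := by
    intro θ
    simp only [deriv_circleMap, periodic_circleMap _ _ θ]
  have h := hper.intervalIntegral_add_eq 0 (-π)
  rw [zero_add, show -π + 2 * π = π by ring] at h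
  rw [circleIntegral, h, intervalIntegral.integral_of_le (by linarith [Real.pi_pos]),
    integral_Ioc_eq_integral_Ioo]
  simp only [deriv_circleMap, smul_eq_mul]

/-- The annular sector in polar coordinates is mapped into a set of finite area, so the integral
of a function over it is controlled by its area integral. -/
theorem setLIntegral_circleMap_le {δ ρ : ℝ} (hδ : 0 < δ) (c : ℂ) (F : ℂ → ℝ≥0∞) :
    ∫⁻ p in Ioo δ ρ ×ˢ Ioo (-π) π, F (circleMap c p.1 p.2) ≤
      (ENNReal.ofReal δ)⁻¹ * ∫⁻ w in Metric.ball c ρ, F w := by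
  have hδ0 : ENNReal.ofReal δ ≠ 0 := by simpa using hδ
  have hmeas : MeasurableSet (Ioo δ ρ ×ˢ Ioo (-π) π) := measurableSet_Ioo.prod measurableSet_Ioo
  have hsub : Ioo δ ρ ×ˢ Ioo (-π) π ⊆ polarCoord.target :=
    prod_mono (fun r hr => hδ.trans hr.1) Subset.rfl
  rw [← lintegral_indicator measurableSet_ball, ← lintegral_add_right_eq_self _ c,
    ← Complex.lintegral_comp_polarCoord_symm, ← lintegral_const_mul' _ _ (by simpa using hδ)]
  refine le_trans ?_ (lintegral_mono_set hsub)
  refine setLIntegral_mono' hmeas fun p hp => ?_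
  have hball : circleMap c p.1 p.2 ∈ Metric.ball c ρ := by
    rw [Metric.mem_ball, dist_eq_norm, circleMap_sub_center, norm_circleMap_zero,
      abs_of_pos (hδ.trans hp.1.1)]
    exact hp.1.2
  rw [← circleMap_eq_add_polarCoord_symm, indicator_of_mem hball, smul_eq_mul, ← mul_assoc]
  refine le_mul_of_one_le_left' ?_
  -- The Jacobian r is at least δ on the sector, so dropping it costs at most the factor 1/δ.
  rw [← ENNReal.inv_mul_cancel hδ0 ENNReal.ofReal_ne_top]
  gcongr
  exact hp.1.1.le

theorem lintegral_ball_inv_lt_top (ρ : ℝ) :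
    ∫⁻ u in Metric.ball (0 : ℂ) ρ, ‖u⁻¹‖ₑ < ∞ := by
  rw [← lintegral_indicator measurableSet_ball, ← Complex.lintegral_comp_polarCoord_symm]
  calc _ ≤ ∫⁻ p in polarCoord.target, (Ioo (0 : ℝ) ρ ×ˢ Ioo (-π) π).indicator 1 p := by
        refine setLIntegral_mono' polarCoord.open_target.measurableSet fun p hp => ?_
        have hp1 : 0 < p.1 := hp.1
        have hn : ‖Complex.polarCoord.symm p‖ = p.1 := by
          rw [Complex.norm_polarCoord_symm, abs_of_pos hp1]
        by_cases hb : Complex.polarCoord.symm p ∈ Metric.ball (0 : ℂ) ρ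
        · have hpm : p ∈ Ioo (0 : ℝ) ρ ×ˢ Ioo (-π) π :=
            ⟨⟨hp1, by rwa [mem_ball_zero_iff, hn] at hb⟩, hp.2⟩
          rw [indicator_of_mem hb, indicator_of_mem hpm, Pi.one_apply, smul_eq_mul,
            ← ofReal_norm, norm_inv, hn, ← ENNReal.ofReal_mul hp1.le,
            mul_inv_cancel₀ hp1.ne', ENNReal.ofReal_one]
        · rw [indicator_of_notMem hb, smul_zero]
          exact zero_le
    _ ≤ ∫⁻ p, (Ioo (0 : ℝ) ρ ×ˢ Ioo (-π) π).indicator 1 p := setLIntegral_le_lintegral _ _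
    _ = volume (Ioo (0 : ℝ) ρ ×ˢ Ioo (-π) π) :=
        lintegral_indicator_one (measurableSet_Ioo.prod measurableSet_Ioo)
    _ < ∞ := by
        rw [Measure.volume_eq_prod, Measure.prod_prod, Real.volume_Ioo, Real.volume_Ioo]
        exact ENNReal.mul_lt_top ENNReal.ofReal_lt_top ENNReal.ofReal_lt_top

/-- The Cauchy kernel is integrable in polar coordinates, uniformly in its pole. -/
theorem exists_setLIntegral_kernel_le {δ ρ : ℝ} (hδ : 0 < δ) (c : ℂ) (R : ℝ) :
    ∃ M < ∞, ∀ z : ℂ, ‖z - c‖ ≤ R →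
      ∫⁻ p in Ioo δ ρ ×ˢ Ioo (-π) π, ‖(circleMap c p.1 p.2 - z)⁻¹‖ₑ ≤ M := by
  refine ⟨(ENNReal.ofReal δ)⁻¹ * ∫⁻ u in Metric.ball (0 : ℂ) (ρ + R), ‖u⁻¹‖ₑ,
    ENNReal.mul_lt_top (by simpa using hδ) (lintegral_ball_inv_lt_top _), fun z hz => ?_⟩
  -- Moving the pole to 0 puts the disc of radius ρ about c inside the disc of radius ρ + R about 0,
  -- whichever z is taken.
  refine (setLIntegral_circleMap_le hδ c fun w => ‖(w - z)⁻¹‖ₑ).trans ?_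
  refine mul_le_mul_right ?_ _
  rw [← lintegral_indicator measurableSet_ball, ← lintegral_indicator measurableSet_ball,
    ← lintegral_sub_right_eq_self (fun u => (Metric.ball (0 : ℂ) (ρ + R)).indicator _ u) z]
  refine lintegral_mono fun w => ?_
  by_cases hw : w ∈ Metric.ball c ρ
  · have : w - z ∈ Metric.ball (0 : ℂ) (ρ + R) := by
      rw [mem_ball_zero_iff]
      rw [Metric.mem_ball, dist_eq_norm] at hw
      have := norm_sub_le (w - c) (z - c)
      rw [sub_sub_sub_cancel_right] at this
      linarith
    rw [indicator_of_mem hw, indicator_of_mem this]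
  · rw [indicator_of_notMem hw]
    exact zero_le

theorem ae_circleMap_notMem {δ ρ : ℝ} (hδ : 0 < δ) (c : ℂ) {N : Set ℂ} (hm : MeasurableSet N)
    (hN : volume N = 0) :
    ∀ᵐ p ∂(volume.restrict (Ioo δ ρ ×ˢ Ioo (-π) π)), circleMap c p.1 p.2 ∉ N := by
  have h := setLIntegral_circleMap_le (ρ := ρ) hδ c (N.indicator 1)
  have h0 : ∫⁻ w in Metric.ball c ρ, N.indicator 1 w = 0 := le_antisymm
    ((setLIntegral_le_lintegral _ _).trans (by rw [lintegral_indicator_one hm, hN])) zero_le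
  have hmeas : Measurable fun p : ℝ × ℝ => N.indicator (1 : ℂ → ℝ≥0∞) (circleMap c p.1 p.2) :=
    (measurable_one.indicator hm).comp (continuous_circleMap_uncurried c).measurable
  rw [h0, mul_zero, nonpos_iff_eq_zero, lintegral_eq_zero_iff hmeas] at h
  filter_upwards [h] with p hp hpN
  simp [hpN] at hp

/-- A Lipschitz image of a subset of the line has Hausdorff dimension at most 1, less than 2. -/
theorem volume_image_eq_zero_of_lipschitzWith {f : ℝ → ℂ} {C : ℝ≥0} (hf : LipschitzWith C f)
    (s : Set ℝ) : volume (f '' s) = 0 := by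
  have hdim : dimH (f '' s) < (2 : ℝ≥0) :=
    ((hf.dimH_image_le s).trans (dimH_mono (subset_univ s))).trans_lt (by
      rw [Real.dimH_univ]; norm_num)
  refine measure_zero_of_dimH_lt ?_ hdim
  have h := isAddHaarMeasure_hausdorffMeasure (E := ℂ)
  rw [Complex.finrank_real_complex] at h
  have : (μH[((2 : ℝ≥0) : ℝ)] : Measure ℂ).IsAddHaarMeasure := by simpa using h
  exact Measure.absolutelyContinuous_isAddHaarMeasure _ _

/-! ### Averaging over circles and integrating along the curve -/

section averaging

variable {c : ℂ} {δ ε R : ℝ} {h : ℂ →ᵇ ℂ}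

theorem integrableOn_kernel (hδ : 0 < δ) (c z : ℂ) (ρ : ℝ) :
    IntegrableOn (fun p : ℝ × ℝ => (circleMap c p.1 p.2 - z)⁻¹) (Ioo δ ρ ×ˢ Ioo (-π) π) := by
  obtain ⟨M, hM, hle⟩ := exists_setLIntegral_kernel_le (ρ := ρ) hδ c ‖z - c‖
  exact ⟨((continuous_circleMap_uncurried c).measurable.sub_const z).inv.aestronglyMeasurable,
    (hle z le_rfl).trans_lt hM⟩

theorem norm_circleMap_mul_le (hδ : 0 < δ) {ρ : ℝ} {p : ℝ × ℝ}
    (hp : p ∈ Ioo δ ρ ×ˢ Ioo (-π) π) :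
    ‖circleMap 0 p.1 p.2 * h (circleMap c p.1 p.2)‖ ≤ ρ * ‖h‖ := by
  rw [norm_mul, norm_circleMap_zero, abs_of_pos (hδ.trans hp.1.1)]
  exact mul_le_mul hp.1.2.le (h.norm_coe_le_norm _) (norm_nonneg _)
    ((hδ.trans hp.1.1).le.trans hp.1.2.le)

theorem measurable_circleMap_mul :
    Measurable fun p : ℝ × ℝ => circleMap 0 p.1 p.2 * h (circleMap c p.1 p.2) :=
  (continuous_circleMap_uncurried 0).measurable.mul
    (h.continuous.comp (continuous_circleMap_uncurried c)).measurable

/-- The integral measures the radii in (δ, δ + ε) below x, which is how the ramp arises from the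
indicator of the exterior. -/
theorem setIntegral_max_min (x : ℝ) (a : ℂ) :
    ∫ r in Ioo δ (δ + ε), (if r < x then a else 0) = (max 0 (min ε (x - δ)) : ℝ) * a := by
  have h1 : ∀ r, (if r < x then a else 0) = (Iio x).indicator (fun _ => a) r := fun r => by
    simp only [indicator, mem_Iio]
  simp only [h1]
  rw [setIntegral_indicator measurableSet_Iio, setIntegral_const, Ioo_inter_Iio, Measure.real,
    Real.volume_Ioo, ENNReal.toReal_ofReal', Complex.real_smul, max_comm,
    min_sub_sub_right (δ + ε) x δ |>.symm, add_sub_cancel_left]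

/-- Integrating the Cauchy integral of `h` over the circles of radii between `δ` and `δ + ε`. -/
theorem setIntegral_cauchy (hδ : 0 < δ) (hε : 0 < ε)
    (hh : ∀ w, δ ≤ ‖w - c‖ → DifferentiableAt ℂ h w) {z : ℂ} (hzR : ‖z - c‖ < R)
    (hR : δ + ε ≤ R) :
    ∫ p in Ioo δ (δ + ε) ×ˢ Ioo (-π) π,
        circleMap 0 p.1 p.2 * h (circleMap c p.1 p.2) * (circleMap c p.1 p.2 - z)⁻¹ =
      -(ε * Complex.I) * (∮ w in C(c, R), h w / (w - z)) -
        2 * π * ((max 0 (min ε (‖z - c‖ - δ)) : ℝ) * h z) := by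
  have hint : IntegrableOn (fun p : ℝ × ℝ =>
      circleMap 0 p.1 p.2 * h (circleMap c p.1 p.2) * (circleMap c p.1 p.2 - z)⁻¹)
      (Ioo δ (δ + ε) ×ˢ Ioo (-π) π) :=
    (integrableOn_kernel hδ c z (δ + ε)).bdd_mul measurable_circleMap_mul.aestronglyMeasurable <| by
      filter_upwards [ae_restrict_mem (measurableSet_Ioo.prod measurableSet_Ioo)] with p hp
      exact norm_circleMap_mul_le hδ hp
  rw [Measure.volume_eq_prod, setIntegral_prod _ hint]
  have hinner : ∀ᵐ r ∂(volume.restrict (Ioo δ (δ + ε))),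
      (∫ θ in Ioo (-π) π,
        circleMap 0 r θ * h (circleMap c r θ) * (circleMap c r θ - z)⁻¹) =
      -Complex.I * (∮ w in C(c, R), h w / (w - z)) -
        if r < ‖z - c‖ then 2 * π * h z else 0 := by
    -- The one radius whose circle passes through z is discarded as null.
    filter_upwards [ae_restrict_mem measurableSet_Ioo,
      ae_restrict_of_ae (Measure.ae_ne volume ‖z - c‖)] with r hr hrz
    have hc := circleIntegral_div_sub_eq (hδ.trans hr.1) (hr.2.le.trans hR)
      (fun w hw => hh w (hr.1.le.trans hw)) hzR hrz.symm
    rw [circleIntegral_eq_setIntegral_Ioo] at hc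
    have h1 : ∀ θ, circleMap 0 r θ * h (circleMap c r θ) * (circleMap c r θ - z)⁻¹ =
        -Complex.I * (circleMap 0 r θ * Complex.I *
          (h (circleMap c r θ) / (circleMap c r θ - z))) := fun θ => by
      rw [div_eq_mul_inv]
      linear_combination (circleMap 0 r θ * h (circleMap c r θ) * (circleMap c r θ - z)⁻¹) *
        Complex.I_mul_I
    simp only [h1]
    rw [integral_const_mul, hc, mul_sub]
    congr 1
    split_ifs
    · linear_combination (-(2 * π * h z)) * Complex.I_mul_I
    · rw [mul_zero]
  rw [integral_congr_ae hinner, integral_sub (integrable_const _), setIntegral_max_min,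
    setIntegral_const, Measure.real, Real.volume_Ioo, add_sub_cancel_left,
    ENNReal.toReal_ofReal hε.le, Complex.real_smul]
  · ring
  · have h1 : ∀ r, (if r < ‖z - c‖ then 2 * π * h z else 0) =
        (Iio ‖z - c‖).indicator (fun _ => 2 * π * h z) r := fun r => by
      simp only [indicator, mem_Iio]
    simp only [h1]
    exact (integrable_const _).indicator measurableSet_Iio

variable {f : ℝ → ℂ} {C : ℝ≥0} {L : ℝ}

theorem setIntegral_deriv_mul_inv (hL : 0 ≤ L) (w : ℂ) :
    ∫ t in Ioc 0 L, deriv f t * (w - f t)⁻¹ = -windingIntegral f L w := by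
  rw [windingIntegral, intervalIntegral.integral_of_le hL, ← integral_neg]
  refine integral_congr_ae (Filter.Eventually.of_forall fun t => ?_)
  simp only
  rw [← neg_sub (f t) w, inv_neg, mul_neg, div_eq_mul_inv]

theorem integrable_prod_kernel (hδ : 0 < δ) (hf : LipschitzWith C f)
    (hR : ∀ t ∈ Icc 0 L, ‖f t - c‖ ≤ R) (ρ : ℝ) :
    Integrable (fun q : ℝ × ℝ × ℝ =>
      deriv f q.1 * (circleMap 0 q.2.1 q.2.2 * h (circleMap c q.2.1 q.2.2) *
        (circleMap c q.2.1 q.2.2 - f q.1)⁻¹))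
      ((volume.restrict (Ioc 0 L)).prod (volume.restrict (Ioo δ ρ ×ˢ Ioo (-π) π))) := by
  have hmeas : Measurable fun q : ℝ × ℝ × ℝ => (circleMap c q.2.1 q.2.2 - f q.1)⁻¹ :=
    (((continuous_circleMap_uncurried c).measurable.comp measurable_snd).sub
      (hf.continuous.measurable.comp measurable_fst)).inv
  have hker : Integrable (fun q : ℝ × ℝ × ℝ => (circleMap c q.2.1 q.2.2 - f q.1)⁻¹)
      ((volume.restrict (Ioc 0 L)).prod (volume.restrict (Ioo δ ρ ×ˢ Ioo (-π) π))) := by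
    obtain ⟨M, hM, hle⟩ := exists_setLIntegral_kernel_le (ρ := ρ) hδ c R
    refine ⟨hmeas.aestronglyMeasurable, ?_⟩
    rw [HasFiniteIntegral, lintegral_prod _ hmeas.enorm.aemeasurable]
    refine (setLIntegral_mono' measurableSet_Ioc fun t ht =>
      hle (f t) (hR t (Ioc_subset_Icc_self ht))).trans_lt ?_
    rw [setLIntegral_const]
    exact ENNReal.mul_lt_top hM (by simp)
  have hmem : ∀ᵐ q ∂((volume.restrict (Ioc 0 L)).prod
      (volume.restrict (Ioo δ ρ ×ˢ Ioo (-π) π))), q.2 ∈ Ioo δ ρ ×ˢ Ioo (-π) π :=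
    Measure.quasiMeasurePreserving_snd.ae
      (ae_restrict_mem (measurableSet_Ioo.prod measurableSet_Ioo))
  have := (hker.bdd_mul (measurable_circleMap_mul (c := c) (h := h) |>.comp
    measurable_snd).aestronglyMeasurable
    (hmem.mono fun q hq => norm_circleMap_mul_le hδ hq)).bdd_mul
      ((measurable_deriv f).comp measurable_fst).aestronglyMeasurable
      (Filter.Eventually.of_forall fun q => norm_deriv_le_of_lipschitz (x₀ := q.1) hf)
  exact this

/-- Cauchy integrals over a circle around a closed curve integrate to zero along the curve. -/
theorem setIntegral_deriv_mul_circleIntegral (hL : 0 ≤ L) (hf : LipschitzWith C f)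
    (hcl : f 0 = f L) {R₀ : ℝ} (hR₀ : ∀ t ∈ Icc 0 L, ‖f t - c‖ ≤ R₀) (hR : R₀ < R) :
    IntegrableOn (fun t => deriv f t * ∮ w in C(c, R), h w / (w - f t)) (Ioc 0 L) ∧
    ∫ t in Ioc 0 L, deriv f t * (∮ w in C(c, R), h w / (w - f t)) = 0 := by
  have hR₀0 : 0 ≤ R₀ := (norm_nonneg _).trans (hR₀ 0 (left_mem_Icc.2 hL))
  have hR0 : 0 < R := hR₀0.trans_lt hR
  have hnorm : ∀ θ, ‖circleMap c R θ - c‖ = R := fun θ => by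
    rw [circleMap_sub_center, norm_circleMap_zero, abs_of_pos hR0]
  have hdist : ∀ t ∈ Icc 0 L, ∀ θ, R - R₀ ≤ ‖circleMap c R θ - f t‖ := fun t ht θ => by
    have h1 := norm_sub_norm_le (circleMap c R θ - c) (f t - c)
    rw [hnorm, sub_sub_sub_cancel_right] at h1
    linarith [hR₀ t ht]
  have hcm : Continuous (circleMap c R) := continuous_circleMap c R
  have hint : Integrable (Function.uncurry fun t θ => circleMap 0 R θ * Complex.I *
      h (circleMap c R θ) * (deriv f t * (circleMap c R θ - f t)⁻¹))
      ((volume.restrict (Ioc 0 L)).prod (volume.restrict (Ioo (-π) π))) := by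
    refine Integrable.of_bound (C := R * ‖h‖ * (C * (R - R₀)⁻¹)) ?_ ?_
    · refine Measurable.aestronglyMeasurable ?_
      refine Measurable.mul (Continuous.measurable ?_) (Measurable.mul ?_ ?_)
      · have := continuous_circleMap 0 R
        have := h.continuous
        fun_prop
      · exact (measurable_deriv f).comp measurable_fst
      · exact ((hcm.measurable.comp measurable_snd).sub
          (hf.continuous.measurable.comp measurable_fst)).inv
    · filter_upwards [Measure.quasiMeasurePreserving_fst.ae
        (ae_restrict_mem (μ := volume) measurableSet_Ioc)] with q hq
      rw [Function.uncurry, norm_mul, norm_mul, norm_mul, norm_mul, norm_circleMap_zero,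
        Complex.norm_I, mul_one, abs_of_pos hR0, norm_inv]
      have h1 : 0 < R - R₀ := sub_pos.2 hR
      gcongr
      · exact h.norm_coe_le_norm _
      · exact norm_deriv_le_of_lipschitz hf
      · exact hdist _ (Ioc_subset_Icc_self hq) _
  have heq : ∀ t, deriv f t * (∮ w in C(c, R), h w / (w - f t)) =
      ∫ θ in Ioo (-π) π, circleMap 0 R θ * Complex.I *
        h (circleMap c R θ) * (deriv f t * (circleMap c R θ - f t)⁻¹) := fun t => by
    rw [circleIntegral_eq_setIntegral_Ioo, ← integral_const_mul]
    refine integral_congr_ae (Filter.Eventually.of_forall fun θ => ?_)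
    simp only [div_eq_mul_inv]
    ring
  simp only [heq]
  refine ⟨hint.integral_prod_left, ?_⟩
  rw [integral_integral_swap hint]
  refine integral_eq_zero_of_ae (Filter.Eventually.of_forall fun θ => ?_)
  -- For fixed θ the inner integral is a multiple of the winding integral about a point of the large
  -- circle, which is farther from c than the whole curve.
  simp only
  rw [integral_const_mul, setIntegral_deriv_mul_inv hL, windingIntegral_eq_zero_of_norm_le hL hf hcl
    (c := c), neg_zero, mul_zero, Pi.zero_apply]
  · rintro ⟨t, ht, hft⟩
    have := hdist t ht θ
    rw [hft, sub_self, norm_zero] at this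
    linarith
  · intro t ht
    rw [hnorm]
    exact (hR₀ t ht).trans hR.le

/-- Both sides of `setIntegral_cauchy` are integrated along the curve. After Fubini the area side is
bounded by (δ + ε)‖h‖ · 2π on a parameter rectangle of measure 2πε; one factor 2π then cancels
against that of Cauchy's formula. -/
theorem norm_setIntegral_max_min_le (hL : 0 ≤ L) (hf : LipschitzWith C f) (hcl : f 0 = f L)
    (hW : ∀ w ∉ f '' Icc 0 L, ‖windingIntegral f L w‖ ≤ 2 * π)
    (hδ : 0 < δ) (hε : 0 < ε) (hh : ∀ w, δ ≤ ‖w - c‖ → DifferentiableAt ℂ h w) :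
    ‖∫ t in Ioc 0 L, deriv f t * ((max 0 (min ε (‖f t - c‖ - δ)) : ℝ) * h (f t))‖ ≤
      2 * π * ‖h‖ * (δ + ε) * ε := by
  obtain ⟨R₀, hR₀⟩ := (isCompact_Icc (a := (0 : ℝ)) (b := L)).exists_bound_of_continuousOn
    (f := fun t => f t - c) (hf.continuous.sub continuous_const).continuousOn
  -- The large circle must enclose the annulus and, strictly, the curve.
  set R := max R₀ (δ + ε) + 1 with hRdef
  have hR₀R : R₀ < R := (le_max_left _ _).trans_lt (lt_add_one _)
  have hδR : δ + ε ≤ R := (le_max_right _ _).trans (lt_add_one _).le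
  obtain ⟨hHint, hH⟩ := setIntegral_deriv_mul_circleIntegral (h := h) hL hf hcl hR₀ hR₀R
  have hprod := integrable_prod_kernel (h := h) hδ hf hR₀ (δ + ε)
  have hπ := Real.pi_pos
  set D := Ioo δ (δ + ε) ×ˢ Ioo (-π) π with hD
  have hDm : MeasurableSet D := measurableSet_Ioo.prod measurableSet_Ioo
  have hvol : volume.real D = ε * (2 * π) := by
    rw [Measure.real, Measure.volume_eq_prod, Measure.prod_prod, Real.volume_Ioo,
      Real.volume_Ioo, ENNReal.toReal_mul, ENNReal.toReal_ofReal (by linarith),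
      ENNReal.toReal_ofReal (by linarith)]
    ring
  have hA : 2 * π * ∫ t in Ioc 0 L,
      deriv f t * ((max 0 (min ε (‖f t - c‖ - δ)) : ℝ) * h (f t)) =
      -∫ t in Ioc 0 L, ∫ p in D, deriv f t * (circleMap 0 p.1 p.2 * h (circleMap c p.1 p.2) *
        (circleMap c p.1 p.2 - f t)⁻¹) := by
    have h1 := integral_sub (hHint.const_mul (-(ε * Complex.I))) hprod.integral_prod_left
    rw [integral_const_mul, hH, mul_zero, zero_sub] at h1
    rw [← integral_const_mul, ← h1]
    refine setIntegral_congr_fun measurableSet_Ioc fun t ht => ?_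
    have htR := (hR₀ t (Ioc_subset_Icc_self ht)).trans_lt hR₀R
    simp only
    rw [integral_const_mul, setIntegral_cauchy hδ hε hh htR hδR]
    ring
  have hB : ‖∫ t in Ioc 0 L, ∫ p in D, deriv f t * (circleMap 0 p.1 p.2 *
      h (circleMap c p.1 p.2) * (circleMap c p.1 p.2 - f t)⁻¹)‖ ≤
      (δ + ε) * ‖h‖ * (2 * π) * (ε * (2 * π)) := by
    rw [integral_integral_swap hprod, ← hvol]
    -- The winding bound holds only off the curve, which almost every point of the annulus avoids.
    have hnull := ae_circleMap_notMem (ρ := δ + ε) hδ c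
      (isCompact_Icc.image hf.continuous).isClosed.measurableSet
      (volume_image_eq_zero_of_lipschitzWith hf (Icc 0 L))
    refine norm_setIntegral_le_of_norm_le_const_ae' ?_ ?_
    · rw [Measure.volume_eq_prod, Measure.prod_prod]
      simp [ENNReal.mul_lt_top]
    · rw [← ae_restrict_iff' hDm]
      filter_upwards [hnull, ae_restrict_mem hDm] with p hp hpD
      have h1 : ∀ t, deriv f t * (circleMap 0 p.1 p.2 * h (circleMap c p.1 p.2) *
          (circleMap c p.1 p.2 - f t)⁻¹) = circleMap 0 p.1 p.2 * h (circleMap c p.1 p.2) *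
          (deriv f t * (circleMap c p.1 p.2 - f t)⁻¹) := fun t => by ring
      simp only [h1]
      rw [integral_const_mul, setIntegral_deriv_mul_inv hL, norm_mul, norm_neg]
      exact mul_le_mul (norm_circleMap_mul_le hδ hpD) (hW _ hp) (norm_nonneg _)
        (mul_nonneg (by linarith) (norm_nonneg _))
  rw [← norm_neg, ← hA, norm_mul, ← Complex.ofReal_ofNat, ← Complex.ofReal_mul, Complex.norm_real,
    Real.norm_of_nonneg Real.two_pi_pos.le] at hB
  refine le_of_mul_le_mul_left (hB.trans_eq ?_) Real.two_pi_pos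
  ring

/-- For δ < x the quotient equals 1 once ε < x - δ; otherwise it is 0. The limit is thus the
indicator of the open exterior, excluding the boundary circle. -/
theorem tendsto_max_min_div (x : ℝ) :
    Filter.Tendsto (fun ε : ℝ => max 0 (min ε (x - δ)) / ε) (nhdsWithin 0 (Ioi 0))
      (nhds (if δ < x then 1 else 0)) := by
  split_ifs with hx
  · refine tendsto_const_nhds.congr' ?_
    filter_upwards [self_mem_nhdsWithin, mem_nhdsWithin_of_mem_nhds (Iio_mem_nhds (sub_pos.2 hx))]
      with ε hε hεx
    rw [min_eq_left (mem_Iio.1 hεx).le, max_eq_right (mem_Ioi.1 hε).le, div_self (mem_Ioi.1 hε).ne']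
  · refine tendsto_const_nhds.congr' ?_
    filter_upwards [self_mem_nhdsWithin] with ε hε
    have : min ε (x - δ) ≤ 0 := (min_le_right _ _).trans (by linarith)
    rw [max_eq_left this, zero_div]

theorem norm_setIntegral_outside_disc_le (hL : 0 ≤ L) (hf : LipschitzWith C f) (hcl : f 0 = f L)
    (hW : ∀ w ∉ f '' Icc 0 L, ‖windingIntegral f L w‖ ≤ 2 * π)
    (hδ : 0 < δ) (hh : ∀ w, δ ≤ ‖w - c‖ → DifferentiableAt ℂ h w) :
    ‖∫ t in Ioc 0 L, (if δ < ‖f t - c‖ then h (f t) * deriv f t else 0)‖ ≤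
      2 * π * ‖h‖ * δ := by
  have hlim : Filter.Tendsto (fun ε : ℝ => ∫ t in Ioc 0 L,
      ((max 0 (min ε (‖f t - c‖ - δ)) / ε : ℝ) : ℂ) * (h (f t) * deriv f t))
      (nhdsWithin 0 (Ioi 0))
      (nhds (∫ t in Ioc 0 L, (if δ < ‖f t - c‖ then h (f t) * deriv f t else 0))) := by
    refine tendsto_integral_filter_of_dominated_convergence (fun _ => ‖h‖ * C) ?_ ?_ ?_ ?_
    · refine Filter.Eventually.of_forall fun ε => Measurable.aestronglyMeasurable ?_
      refine Measurable.mul (Continuous.measurable ?_)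
        ((h.continuous.comp hf.continuous).measurable.mul (measurable_deriv f))
      have := hf.continuous
      fun_prop
    · filter_upwards [self_mem_nhdsWithin] with ε hε
      refine Filter.Eventually.of_forall fun t => ?_
      have hε0 : 0 < ε := hε
      have h1 : max 0 (min ε (‖f t - c‖ - δ)) / ε ≤ 1 :=
        div_le_one_of_le₀ (max_le hε0.le (min_le_left _ _)) hε0.le
      have h0 : 0 ≤ max 0 (min ε (‖f t - c‖ - δ)) / ε := div_nonneg (le_max_left _ _) hε0.le
      rw [norm_mul, norm_mul, Complex.norm_real, Real.norm_of_nonneg h0]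
      refine (mul_le_of_le_one_left (by positivity) h1).trans ?_
      exact mul_le_mul (h.norm_coe_le_norm _) (norm_deriv_le_of_lipschitz hf) (norm_nonneg _)
        (norm_nonneg _)
    · exact integrable_const _
    · refine Filter.Eventually.of_forall fun t => ?_
      have h1 := ((Complex.continuous_ofReal.tendsto _).comp
        (tendsto_max_min_div (δ := δ) ‖f t - c‖)).mul_const (h (f t) * deriv f t)
      have h2 : (((if δ < ‖f t - c‖ then 1 else 0 : ℝ)) : ℂ) * (h (f t) * deriv f t) =
          if δ < ‖f t - c‖ then h (f t) * deriv f t else 0 := by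
        split_ifs <;> simp
      rw [h2] at h1
      exact h1
  have hrhs : Filter.Tendsto (fun ε : ℝ => 2 * π * ‖h‖ * (δ + ε)) (nhdsWithin 0 (Ioi 0))
      (nhds (2 * π * ‖h‖ * δ)) := by
    have : Continuous fun ε : ℝ => 2 * π * ‖h‖ * (δ + ε) := by fun_prop
    simpa using (this.tendsto 0).mono_left nhdsWithin_le_nhds
  refine le_of_tendsto_of_tendsto hlim.norm hrhs ?_
  filter_upwards [self_mem_nhdsWithin] with ε hε
  have hε0 : 0 < ε := hε
  have h1 : ∀ t, ((max 0 (min ε (‖f t - c‖ - δ)) / ε : ℝ) : ℂ) * (h (f t) * deriv f t) =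
      (ε : ℂ)⁻¹ * (deriv f t * ((max 0 (min ε (‖f t - c‖ - δ)) : ℝ) * h (f t))) := fun t => by
    rw [Complex.ofReal_div]
    ring
  simp only [h1]
  rw [integral_const_mul, norm_mul, norm_inv, Complex.norm_real, Real.norm_of_nonneg hε0.le,
    inv_mul_le_iff₀ hε0, mul_comm ε]
  exact norm_setIntegral_max_min_le hL hf hcl hW hδ hε0 hh

end averaging

/-! ### The estimate for the line integral -/

theorem mainTheorem4 (γ : ℝ → ℂ) (a b : ℝ) (hγ : IsRectifiableJordanCurve γ a b)
    (c : ℂ) (δ : ℝ) (hδ : 0 < δ) (h : ℂ →ᵇ ℂ) (K : Set ℂ) (hK : IsCompact K)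
    (hKΔ : K ⊆ Metric.ball c δ) (hh : DifferentiableOn ℂ h Kᶜ) :
    ‖lineIntegralOn γ a b (closure (Metric.ball c δ))ᶜ h‖ ≤ 2 * π * ‖h‖ * δ := by
  have hL : 0 ≤ curveLength γ a b := ENNReal.toReal_nonneg
  -- The lemmas on curves need a globally Lipschitz function; σ is controlled only on [0, L].
  obtain ⟨f, hf, hfσ⟩ := hγ.lipschitzOnWith_arcLengthParam.exists_lipschitzWith_eqOn_Icc hL
  have hcl : f 0 = f (curveLength γ a b) := by
    rw [← hfσ (left_mem_Icc.2 hL), ← hfσ (right_mem_Icc.2 hL), hγ.arcLengthParam_closed]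
  have hinj : InjOn f (Ico 0 (curveLength γ a b)) :=
    hγ.injOn_arcLengthParam.congr (hfσ.mono Ico_subset_Icc_self)
  have hhd : ∀ w, δ ≤ ‖w - c‖ → DifferentiableAt ℂ h w := fun w hw =>
    hh.differentiableAt (hK.isClosed.isOpen_compl.mem_nhds fun hwK => by
      have := hKΔ hwK
      rw [Metric.mem_ball, dist_eq_norm] at this
      linarith)
  refine le_trans (le_of_eq (congrArg norm ?_)) (norm_setIntegral_outside_disc_le hL hf hcl
    (fun w hw => norm_windingIntegral_le_two_pi hL hf hcl hinj hw) hδ hhd)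
  have hset : {s ∈ Icc 0 (curveLength γ a b) |
      arcLengthParam γ a b s ∈ (closure (Metric.ball c δ))ᶜ} =
      Icc 0 (curveLength γ a b) ∩ {s | δ < ‖f s - c‖} := by
    ext s
    refine and_congr_right fun hs => ?_
    rw [hfσ hs, closure_ball c hδ.ne', mem_compl_iff, Metric.mem_closedBall, dist_eq_norm, not_le]
    rfl
  have hmeas : MeasurableSet {s | δ < ‖f s - c‖} :=
    (isOpen_lt continuous_const (hf.continuous.sub continuous_const).norm).measurableSet
  -- The derivatives of σ and of its extension may differ at the end points, so these are dropped.
  rw [lineIntegralOn, hset, ← setIntegral_indicator hmeas, integral_Icc_eq_integral_Ioo,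
    integral_Ioc_eq_integral_Ioo]
  refine setIntegral_congr_fun measurableSet_Ioo fun s hs => ?_
  simp only [indicator, mem_ofPred_eq, EqOn.deriv_eqOn_Ioo hfσ hs,
    hfσ (Ioo_subset_Icc_self hs)]
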